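/- For real numbers $m,l$ let $F=1+m(x^2+y^2)$ and let $M^3(m,l)$ be the Bianchi–Cartan–Vranceanu (BCV) space $$\{(x,y,z)\in\mathbb R^3: F>0\},\qquad h=\frac{dx^2+dy^2}{F^2}+\Big[dz+\frac l2\,\frac{y\,dx-x\,dy}{F}\Big]^2 ,$$ so that $(x,y,z)\mapsto(x,y)$ is a Riemannian submersion onto the surface $\big(\{F>0\}\subset\mathbb R^2,\ h_1=(dx^2+dy^2)/F^2\big)$ of Gauss curvature $4m$. For $l=0$, $M^3(m,l)$ is the Riemannian product $S^2(4m)\times\mathbb R$ (with the sphere in its stereographic chart) if $m>0$, $H^2(4m)\times\mathbb R$ if $m<0$, and Euclidean $\mathbb R^3$ if $m=0$. For $l\ne0$ it is (a chart of) $S^3$ if $4m=l^2$, $SU(2)$ if $m>0$, $Nil$ if $m=0$, and $\widetilde{SL}(2,\mathbb R)$ if $m<0$. Let $I\subseteq\mathbb R$ be an open interval and $\gamma=(x(s),y(s)):I\to(\{F>0\},h_1)$ a smooth curve parametrized by arc length. The Hopf cylinder over $\gamma$ is the union of the fibres over $\gamma$, parametrized by $\varphi(s,z)=(x(s),y(s),z)$,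 $(s,z)\in I\times\mathbb R$. Let $\Sigma\subseteq I\times\mathbb R$ be a nonempty connected open set (for instance all of $I\times\mathbb R$) and $f:\Sigma\to(0,\infty)$ a smooth function. The conformal immersion $\varphi:(\Sigma,\bar g=f^{-1}\varphi^*h)\to M^3(m,l)$, with conformal factor $f^{1/2}$, is called proper biharmonic if its tension field $\tau(\varphi)=\mathrm{Trace}_{\bar g}\nabla d\varphi$ does not vanish identically on $\Sigma$ while its bitension field $$\tau_2(\varphi)=\mathrm{Trace}_{\bar g}\big(\nabla^\varphi\nabla^\varphi-\nabla^\varphi_{\nabla^{\Sigma}}\big)\tau(\varphi)-\mathrm{Trace}_{\bar g}R^{M}(d\varphi,\tau(\varphi))d\varphi$$ vanishes identically on $\Sigma$, where $R^M(X,Y)Z=[\nabla_X,\nabla_Y]Z-\nabla_{[X,Y]}Z$. (i) If there is a proper biharmonic conformal immersion $\varphi:(\Sigma,f^{-1}\varphi^*h)\to M^3(m,l)$ of this kind with nonconstant conformal factor $f^{1/2}$, then $M^3(m,l)$ is $S^2(c)\times\mathbb R$ for some $c>0$, or $H^2(c)\times\mathbb R$ for some $c<0$, or $\mathbb R^3$.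 (ii) If $M^3(m,l)$ is $S^3$, $Nil$, $\widetilde{SL}(2,\mathbb R)$ or $SU(2)$, then there is no proper biharmonic conformal immersion $\varphi:(\Sigma,f^{-1}\varphi^*h)\to M^3(m,l)$ of this kind with nonconstant conformal factor. -/

import Mathlib

open scoped ContDiff Matrix

noncomputable section

namespace BCV

/-! ## Riemannian geometry in a chart

A Riemannian metric on an open set of `ℝⁿ` is given by its component matrix `g p i j`. -/

/-- The partial derivative `∂F/∂pᵢ`. -/
def partialD {n : ℕ} {E : Type*} [NormedAddCommGroup E] [NormedSpace ℝ E]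
    (i : Fin n) (F : (Fin n → ℝ) → E) (p : Fin n → ℝ) : E :=
  fderiv ℝ F p (Pi.single i 1)

/-- The Christoffel symbol `Γᵏᵢⱼ` of the Levi-Civita connection of `g`. -/
def christoffel {n : ℕ} (g : (Fin n → ℝ) → Matrix (Fin n) (Fin n) ℝ) (k i j : Fin n)
    (p : Fin n → ℝ) : ℝ :=
  (1 / 2) * ∑ r, (g p)⁻¹ k r *
    (partialD i (fun q => g q j r) p + partialD j (fun q => g q i r) p
      - partialD r (fun q => g q i j) p)

/-- The curvature component `Rᵃ_bcd`, where `R(∂_c, ∂_d) ∂_b = Rᵃ_bcd ∂_a` and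
`R(X,Y)Z = ∇_X ∇_Y Z - ∇_Y ∇_X Z - ∇_[X,Y] Z`. -/
def curvature {n : ℕ} (h : (Fin n → ℝ) → Matrix (Fin n) (Fin n) ℝ) (a b c d : Fin n)
    (p : Fin n → ℝ) : ℝ :=
  partialD c (christoffel h a d b) p - partialD d (christoffel h a c b) p
    + ∑ e, (christoffel h a c e p * christoffel h e d b p
      - christoffel h a d e p * christoffel h e c b p)

/-- The vector `R(X,Y)Z` at the point `p`. -/
def curvatureOp {n : ℕ} (h : (Fin n → ℝ) → Matrix (Fin n) (Fin n) ℝ) (p : Fin n → ℝ)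
    (X Y Z : Fin n → ℝ) : Fin n → ℝ :=
  fun a => ∑ b, ∑ c, ∑ d, curvature h a b c d p * X c * Y d * Z b

/-- The pull-back connection: `∇^φ_{∂ᵢ} W` for a vector field `W` along `φ`. -/
def pullbackD {k n : ℕ} (h : (Fin n → ℝ) → Matrix (Fin n) (Fin n) ℝ)
    (φ : (Fin k → ℝ) → (Fin n → ℝ)) (i : Fin k) (W : (Fin k → ℝ) → (Fin n → ℝ))
    (p : Fin k → ℝ) : Fin n → ℝ :=
  fun a => partialD i W p a
    + ∑ b, ∑ c, christoffel h a b c (φ p) * partialD i φ p b * W p c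

/-- The tension field `τ(φ) = Trace_g ∇dφ` of `φ : (M, g) → (N, h)`. -/
def tension {k n : ℕ} (g : (Fin k → ℝ) → Matrix (Fin k) (Fin k) ℝ)
    (h : (Fin n → ℝ) → Matrix (Fin n) (Fin n) ℝ) (φ : (Fin k → ℝ) → (Fin n → ℝ))
    (p : Fin k → ℝ) : Fin n → ℝ :=
  ∑ i, ∑ j, (g p)⁻¹ i j •
    (pullbackD h φ i (partialD j φ) p - ∑ r, christoffel g r i j p • partialD r φ p)

/-- The bitension field
`τ₂(φ) = Trace_g (∇^φ ∇^φ - ∇^φ_{∇^M}) τ(φ) - Trace_g R^N(dφ, τ(φ)) dφ`. -/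
def bitension {k n : ℕ} (g : (Fin k → ℝ) → Matrix (Fin k) (Fin k) ℝ)
    (h : (Fin n → ℝ) → Matrix (Fin n) (Fin n) ℝ) (φ : (Fin k → ℝ) → (Fin n → ℝ))
    (p : Fin k → ℝ) : Fin n → ℝ :=
  ∑ i, ∑ j, (g p)⁻¹ i j •
    (pullbackD h φ i (pullbackD h φ j (tension g h φ)) p
      - ∑ r, christoffel g r i j p • pullbackD h φ r (tension g h φ) p
      - curvatureOp h (φ p) (partialD i φ p) (tension g h φ p) (partialD j φ p))

/-- `φ : (U, g) → (N, h)` is proper biharmonic: biharmonic and not harmonic. -/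
def IsProperBiharmonicOn {k n : ℕ} (g : (Fin k → ℝ) → Matrix (Fin k) (Fin k) ℝ)
    (h : (Fin n → ℝ) → Matrix (Fin n) (Fin n) ℝ) (φ : (Fin k → ℝ) → (Fin n → ℝ))
    (U : Set (Fin k → ℝ)) : Prop :=
  (∀ p ∈ U, bitension g h φ p = 0) ∧ ¬ ∀ p ∈ U, tension g h φ p = 0

/-- The components of `φ*h`. -/
def pullbackMetric {k n : ℕ} (h : (Fin n → ℝ) → Matrix (Fin n) (Fin n) ℝ)
    (φ : (Fin k → ℝ) → (Fin n → ℝ)) (p : Fin k → ℝ) : Matrix (Fin k) (Fin k) ℝ :=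
  Matrix.of fun i j => partialD i φ p ⬝ᵥ (h (φ p) *ᵥ partialD j φ p)

/-! ## Bianchi–Cartan–Vranceanu spaces -/

/-- `F = 1 + m (x² + y²)`. -/
def factor (m x y : ℝ) : ℝ := 1 + m * (x ^ 2 + y ^ 2)

/-- The underlying open set of `M³(m, l)`: all of `ℝ³` if `m ≥ 0`, and the solid cylinder
`1 + m (x² + y²) > 0` if `m < 0`. -/
def space (m : ℝ) : Set (Fin 3 → ℝ) := {p | 0 < factor m (p 0) (p 1)}

/-- The contact form `dz + (l/2) (y dx - x dy) / F`, as a row of components. -/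
def form (m l : ℝ) (p : Fin 3 → ℝ) : Fin 3 → ℝ :=
  ![l / 2 * p 1 / factor m (p 0) (p 1), -(l / 2 * p 0 / factor m (p 0) (p 1)), 1]

/-- The metric `(dx² + dy²) / F² + (dz + (l/2) (y dx - x dy) / F)²` of `M³(m, l)`. -/
def metric (m l : ℝ) (p : Fin 3 → ℝ) : Matrix (Fin 3) (Fin 3) ℝ :=
  Matrix.diagonal ![1 / factor m (p 0) (p 1) ^ 2, 1 / factor m (p 0) (p 1) ^ 2, 0]
    + Matrix.vecMulVec (form m l p) (form m l p)

/-- The metric `(dx² + dy²) / F²`, of Gauss curvature `4m`, of the base surface of the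
Riemannian submersion `(x, y, z) ↦ (x, y)`. -/
def baseMetric (m : ℝ) (q : Fin 2 → ℝ) : Matrix (Fin 2) (Fin 2) ℝ :=
  Matrix.diagonal ![1 / factor m (q 0) (q 1) ^ 2, 1 / factor m (q 0) (q 1) ^ 2]

/-! ## The spaces among them -/

/-- The Riemannian product of the surface of constant curvature `c`, in the conformal chart
`(dx² + dy²) / (1 + (c/4) (x² + y²))²`, with the line. -/
def productMetric (c : ℝ) (p : Fin 3 → ℝ) : Matrix (Fin 3) (Fin 3) ℝ :=
  Matrix.diagonal ![1 / (1 + c / 4 * (p 0 ^ 2 + p 1 ^ 2)) ^ 2,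
    1 / (1 + c / 4 * (p 0 ^ 2 + p 1 ^ 2)) ^ 2, 1]

/-- `M³(m, l)` is the product `S²(c) × ℝ` for some `c > 0` (the sphere being in its
stereographic chart). -/
def IsSphereTimesLine (m l : ℝ) : Prop :=
  ∃ c : ℝ, 0 < c ∧ space m = {p | 0 < 1 + c / 4 * (p 0 ^ 2 + p 1 ^ 2)} ∧
    ∀ p ∈ space m, metric m l p = productMetric c p

/-- `M³(m, l)` is the product `H²(c) × ℝ` for some `c < 0` (the hyperbolic plane being in the
Poincaré disc chart). -/
def IsHyperbolicPlaneTimesLine (m l : ℝ) : Prop :=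
  ∃ c : ℝ, c < 0 ∧ space m = {p | 0 < 1 + c / 4 * (p 0 ^ 2 + p 1 ^ 2)} ∧
    ∀ p ∈ space m, metric m l p = productMetric c p

/-- `M³(m, l)` is `ℝ³` with the flat metric `dx² + dy² + dz²`. -/
def IsEuclidean (m l : ℝ) : Prop :=
  space m = Set.univ ∧ ∀ p, metric m l p = 1

/-- `M³(m, l)` is `S³` (of constant curvature `m = l²/4 > 0`). -/
def IsSphere (m l : ℝ) : Prop := l ≠ 0 ∧ 4 * m = l ^ 2

/-- `M³(m, l)` is the Heisenberg group `Nil`. -/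
def IsNil (m l : ℝ) : Prop := l ≠ 0 ∧ m = 0

/-- `M³(m, l)` is the universal cover of `SL(2, ℝ)`. -/
def IsSLTilde (m l : ℝ) : Prop := l ≠ 0 ∧ m < 0

/-- `M³(m, l)` is `SU(2)`. -/
def IsSU (m l : ℝ) : Prop := l ≠ 0 ∧ 0 < m

/-! ## Hopf cylinders -/

/-- `γ` is a smooth curve in the base surface, parametrized by arc length on the open
interval `I`. -/
structure IsUnitSpeedCurve (m : ℝ) (I : Set ℝ) (γ : ℝ → Fin 2 → ℝ) : Prop where
  isOpen : IsOpen I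
  ordConnected : I.OrdConnected
  smooth : ContDiffOn ℝ ∞ γ I
  mem_base : ∀ s ∈ I, 0 < factor m (γ s 0) (γ s 1)
  unit_speed : ∀ s ∈ I, deriv γ s ⬝ᵥ (baseMetric m (γ s) *ᵥ deriv γ s) = 1

/-- The Hopf cylinder over `γ`, i.e. the union of the fibres over `γ`, parametrized by
`φ(s, z) = (x(s), y(s), z)`. -/
def hopfCylinder (γ : ℝ → Fin 2 → ℝ) (p : Fin 2 → ℝ) : Fin 3 → ℝ :=
  ![γ (p 0) 0, γ (p 0) 1, p 1]

/-- The conformal immersion `φ : (U, f⁻¹ φ*h) → M³(m, l)` of (the part given by the nonempty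
connected open set `U ⊆ I × ℝ` of) the Hopf cylinder over `γ` is proper biharmonic, and its
conformal factor `f^(1/2)` is not constant. -/
structure IsProperBiharmonicHopf (m l : ℝ) (I : Set ℝ) (γ : ℝ → Fin 2 → ℝ)
    (U : Set (Fin 2 → ℝ)) (f : (Fin 2 → ℝ) → ℝ) : Prop where
  curve : IsUnitSpeedCurve m I γ
  isOpen : IsOpen U
  isConnected : IsConnected U
  subset : U ⊆ {p | p 0 ∈ I}
  smooth : ContDiffOn ℝ ∞ f U
  pos : ∀ p ∈ U, 0 < f p
  nonconstant : ¬ ∃ c : ℝ, ∀ p ∈ U, √(f p) = c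
  properBiharmonic : IsProperBiharmonicOn
    (fun p => (f p)⁻¹ • pullbackMetric (metric m l) (hopfCylinder γ) p)
    (metric m l) (hopfCylinder γ) U

end BCV

end

/-! Along the cylinder take the orthonormal frame `X` (horizontal lift of the tangent of `γ`), `ξ`
(unit normal), `V` (vertical). With `θ` the contact form on `∂ₛφ` we have `∂ₛφ = X + θV` and `∂_zφ =
V`. Conformal changes of a surface metric only rescale the trace, so the tension field is `uξ` with
`u = fκ`, where `κ` is the geodesic curvature of `γ` (`tension_hopfCylinder`).

Up to the factor `f`, the bitension field (`bitension_hopfCylinder`) has `V`-component `l(uₛ -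
θu_z)`, `X`-component `-uκ' - 2κ(uₛ - θu_z) + l u_z`, and a second-order `ξ`-component. If `l ≠ 0`,
the first two give `uₛ = θu_z` and `l u_z = uκ'`. Where `u ≠ 0`, equality of mixed derivatives
forces `κ'' = 0`, and the `ξ`-component becomes `κ'² = l²(κ² + l² - 4m)`. Differentiating gives `κκ'
= 0`, so `κ' = 0` and `du = 0` there (`deriv_eq_zero_of_biharmonic`).

Hence `u²` is constant on the connected domain. It is not zero, since the map is not harmonic, so
`κ' = 0` and `du = 0` everywhere and `f = u/κ` is constant (`not_isProperBiharmonicHopf`). Both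
claims follow: a nonconstant factor requires `l = 0`, and then the metric is a product. -/

noncomputable section

namespace BCV

/-! ### Partial derivatives as derivatives along coordinate lines -/

theorem hasDerivAt_partialD {n : ℕ} {E : Type*} [NormedAddCommGroup E] [NormedSpace ℝ E]
    {F : (Fin n → ℝ) → E} {p : Fin n → ℝ} (i : Fin n) (h : DifferentiableAt ℝ F p) :
    HasDerivAt (fun t => F (Function.update p i t)) (partialD i F p) (p i) := by
  have h1 : HasFDerivAt F (fderiv ℝ F p) (Function.update p i (p i)) := by
    rw [Function.update_eq_self]; exact h.hasFDerivAt
  exact h1.comp_hasDerivAt (p i) (hasDerivAt_update p i (p i))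

theorem partialD_eq_of_hasDerivAt {n : ℕ} {E : Type*} [NormedAddCommGroup E] [NormedSpace ℝ E]
    {F : (Fin n → ℝ) → E} {p : Fin n → ℝ} {i : Fin n} {d : E} (h : DifferentiableAt ℝ F p)
    (hd : HasDerivAt (fun t => F (Function.update p i t)) d (p i)) : partialD i F p = d :=
  (hasDerivAt_partialD i h).unique hd

theorem partialD_congr {n : ℕ} {E : Type*} [NormedAddCommGroup E] [NormedSpace ℝ E]
    {F G : (Fin n → ℝ) → E} {p : Fin n → ℝ} {U : Set (Fin n → ℝ)} (hU : IsOpen U) (hp : p ∈ U)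
    (h : ∀ q ∈ U, F q = G q) (i : Fin n) : partialD i F p = partialD i G p := by
  have : F =ᶠ[nhds p] G := by
    filter_upwards [hU.mem_nhds hp] with q hq using h q hq
  simp only [partialD, this.fderiv_eq]

/-! ### Christoffel symbols and curvature of the BCV metric -/

theorem isOpen_space (m : ℝ) : IsOpen (space m) := by
  refine isOpen_lt continuous_const ?_
  unfold factor
  fun_prop

/-- The rational functions `(A x + B y) / F + C + (D + E x y + G x² + H y²) / F²`. -/
def rat (m A B C D E G H : ℝ) (p : Fin 3 → ℝ) : ℝ :=
  (A * p 0 + B * p 1) / factor m (p 0) (p 1) + C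
    + (D + E * (p 0 * p 1) + G * p 0 ^ 2 + H * p 1 ^ 2) / factor m (p 0) (p 1) ^ 2

section

variable {m : ℝ} {p : Fin 3 → ℝ}

theorem differentiableAt_rat (hp : p ∈ space m) (A B C D E G H : ℝ) :
    DifferentiableAt ℝ (rat m A B C D E G H) p := by
  have hF : factor m (p 0) (p 1) ≠ 0 := ne_of_gt hp
  unfold rat
  unfold factor at *
  fun_prop (disch := first | assumption | exact pow_ne_zero 2 hF)

/-- The metric components and the Christoffel symbols all lie in the family `rat`, so its three
partial derivatives supply every derivative needed for the connection and the curvature. -/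
theorem partialD_rat_zero (hp : p ∈ space m) (A B C D E G H : ℝ) :
    partialD 0 (rat m A B C D E G H) p =
      A / factor m (p 0) (p 1) - (A * p 0 + B * p 1) * (2 * m * p 0) / factor m (p 0) (p 1) ^ 2
      + (E * p 1 + 2 * G * p 0) / factor m (p 0) (p 1) ^ 2
      - 2 * (D + E * (p 0 * p 1) + G * p 0 ^ 2 + H * p 1 ^ 2) * (2 * m * p 0)
        / factor m (p 0) (p 1) ^ 3 := by
  refine partialD_eq_of_hasDerivAt (differentiableAt_rat hp A B C D E G H) ?_
  have hF : factor m (p 0) (p 1) ≠ 0 := ne_of_gt hp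
  have hf : HasDerivAt (fun t => factor m t (p 1)) (2 * m * p 0) (p 0) := by
    unfold factor
    convert! (((hasDerivAt_id' (p 0)).fun_pow 2).add_const (p 1 ^ 2)).const_mul m |>.const_add 1 using 1
    simp; ring
  have hx := hasDerivAt_id' (p 0)
  simp only [rat, Function.update_self, ne_eq, Function.update_of_ne, one_ne_zero,
    not_false_eq_true]
  convert! ((((hx.const_mul A).add_const (B * p 1)).fun_div hf hF).add_const C).add
    ((((((hx.mul_const (p 1)).const_mul E).const_add D).add ((hx.fun_pow 2).const_mul G)).add_const
      (H * p 1 ^ 2)).fun_div (hf.fun_pow 2) (pow_ne_zero 2 hF)) using 1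
  field_simp
  simp only [Pi.add_apply]
  push_cast
  ring

theorem partialD_rat_one (hp : p ∈ space m) (A B C D E G H : ℝ) :
    partialD 1 (rat m A B C D E G H) p =
      B / factor m (p 0) (p 1) - (A * p 0 + B * p 1) * (2 * m * p 1) / factor m (p 0) (p 1) ^ 2
      + (E * p 0 + 2 * H * p 1) / factor m (p 0) (p 1) ^ 2
      - 2 * (D + E * (p 0 * p 1) + G * p 0 ^ 2 + H * p 1 ^ 2) * (2 * m * p 1)
        / factor m (p 0) (p 1) ^ 3 := by
  refine partialD_eq_of_hasDerivAt (differentiableAt_rat hp A B C D E G H) ?_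
  have hF : factor m (p 0) (p 1) ≠ 0 := ne_of_gt hp
  have hf : HasDerivAt (fun t => factor m (p 0) t) (2 * m * p 1) (p 1) := by
    unfold factor
    convert! (((hasDerivAt_id' (p 1)).fun_pow 2).const_add (p 0 ^ 2)).const_mul m |>.const_add 1 using 1
    simp; ring
  have hx := hasDerivAt_id' (p 1)
  simp only [rat, Function.update_self, ne_eq, Function.update_of_ne, zero_ne_one,
    not_false_eq_true]
  convert! ((((hx.const_mul B).const_add (A * p 0)).fun_div hf hF).add_const C).add
    ((((((hx.const_mul (p 0)).const_mul E).const_add D).add_const (G * p 0 ^ 2)).add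
      ((hx.fun_pow 2).const_mul H)).fun_div (hf.fun_pow 2) (pow_ne_zero 2 hF)) using 1
  field_simp
  simp only [Pi.add_apply]
  push_cast
  ring

theorem partialD_rat_two (hp : p ∈ space m) (A B C D E G H : ℝ) :
    partialD 2 (rat m A B C D E G H) p = 0 := by
  refine partialD_eq_of_hasDerivAt (differentiableAt_rat hp A B C D E G H) ?_
  simp only [rat, ne_eq, Function.update_of_ne, Fin.reduceEq, not_false_eq_true]
  exact hasDerivAt_const _ _

/-- The components of `metric m l` as rational functions. -/
def metricRat (m l : ℝ) (i j : Fin 3) : (Fin 3 → ℝ) → ℝ :=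
  (![![rat m 0 0 0 1 0 0 (l ^ 2 / 4), rat m 0 0 0 0 (-(l ^ 2 / 4)) 0 0, rat m 0 (l / 2) 0 0 0 0 0],
    ![rat m 0 0 0 0 (-(l ^ 2 / 4)) 0 0, rat m 0 0 0 1 0 (l ^ 2 / 4) 0,
      rat m (-(l / 2)) 0 0 0 0 0 0],
    ![rat m 0 (l / 2) 0 0 0 0 0, rat m (-(l / 2)) 0 0 0 0 0 0, rat m 0 0 1 0 0 0 0]] :
    Fin 3 → Fin 3 → (Fin 3 → ℝ) → ℝ) i j

theorem metric_apply (l : ℝ) (hp : p ∈ space m) (i j : Fin 3) :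
    metric m l p i j = metricRat m l i j p := by
  have hF : factor m (p 0) (p 1) ≠ 0 := ne_of_gt hp
  fin_cases i <;> fin_cases j <;>
    simp [metric, metricRat, rat, form] <;> field_simp <;> ring

/-- The components of the inverse of `metric m l`. -/
def metricInv (m l : ℝ) (p : Fin 3 → ℝ) : Matrix (Fin 3) (Fin 3) ℝ :=
  !![factor m (p 0) (p 1) ^ 2, 0, -(l / 2 * p 1 * factor m (p 0) (p 1));
    0, factor m (p 0) (p 1) ^ 2, l / 2 * p 0 * factor m (p 0) (p 1);
    -(l / 2 * p 1 * factor m (p 0) (p 1)), l / 2 * p 0 * factor m (p 0) (p 1),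
      1 + l ^ 2 / 4 * (p 0 ^ 2 + p 1 ^ 2)]

theorem inv_metric (l : ℝ) (hp : p ∈ space m) : (metric m l p)⁻¹ = metricInv m l p := by
  have hF : factor m (p 0) (p 1) ≠ 0 := ne_of_gt hp
  refine Matrix.inv_eq_right_inv ?_
  ext i j
  simp only [Matrix.mul_apply, Fin.sum_univ_three, metric_apply l hp]
  fin_cases i <;> fin_cases j <;>
    simp [metricInv, metricRat, rat] <;> field_simp <;> ring

/-- The Christoffel symbols of `metric m l`. -/
def gamma (m l : ℝ) (k i j : Fin 3) : (Fin 3 → ℝ) → ℝ :=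
  (![![![rat m (-2 * m) 0 0 0 0 0 0, rat m 0 (-2 * m + l ^ 2 / 4) 0 0 0 0 0, rat m 0 0 0 0 0 0 0],
      ![rat m 0 (-2 * m + l ^ 2 / 4) 0 0 0 0 0, rat m (2 * m - l ^ 2 / 2) 0 0 0 0 0 0,
        rat m 0 0 (l / 2) 0 0 0 0],
      ![rat m 0 0 0 0 0 0 0, rat m 0 0 (l / 2) 0 0 0 0, rat m 0 0 0 0 0 0 0]],
    ![![rat m 0 (2 * m - l ^ 2 / 2) 0 0 0 0 0, rat m (-2 * m + l ^ 2 / 4) 0 0 0 0 0 0,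
        rat m 0 0 (-(l / 2)) 0 0 0 0],
      ![rat m (-2 * m + l ^ 2 / 4) 0 0 0 0 0 0, rat m 0 (-2 * m) 0 0 0 0 0, rat m 0 0 0 0 0 0 0],
      ![rat m 0 0 (-(l / 2)) 0 0 0 0, rat m 0 0 0 0 0 0 0, rat m 0 0 0 0 0 0 0]],
    ![![rat m 0 0 0 0 (l * m - l ^ 3 / 4) 0 0,
        rat m 0 0 0 0 0 (-(l * m - l ^ 3 / 4) / 2) ((l * m - l ^ 3 / 4) / 2),
        rat m (-(l ^ 2 / 4)) 0 0 0 0 0 0],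
      ![rat m 0 0 0 0 0 (-(l * m - l ^ 3 / 4) / 2) ((l * m - l ^ 3 / 4) / 2),
        rat m 0 0 0 0 (-(l * m - l ^ 3 / 4)) 0 0, rat m 0 (-(l ^ 2 / 4)) 0 0 0 0 0],
      ![rat m (-(l ^ 2 / 4)) 0 0 0 0 0 0, rat m 0 (-(l ^ 2 / 4)) 0 0 0 0 0,
        rat m 0 0 0 0 0 0 0]]] :
    Fin 3 → Fin 3 → Fin 3 → (Fin 3 → ℝ) → ℝ) k i j

theorem christoffel_metric (l : ℝ) (hp : p ∈ space m) (k i j : Fin 3) :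
    christoffel (metric m l) k i j p = gamma m l k i j p := by
  have hF : factor m (p 0) (p 1) ≠ 0 := ne_of_gt hp
  have hd : ∀ i j r, partialD i (fun q => metric m l q j r) p = partialD i (metricRat m l j r) p :=
    fun i j r => partialD_congr (isOpen_space m) hp (fun q hq => metric_apply l hq j r) i
  simp only [christoffel, hd, inv_metric l hp, Fin.sum_univ_three]
  obtain ⟨y, hy⟩ : ∃ y, y = p 1 := ⟨_, rfl⟩
  obtain ⟨x, hx⟩ : ∃ x, x = p 0 := ⟨_, rfl⟩
  fin_cases k <;> fin_cases i <;> fin_cases j <;>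
    simp [metricInv, metricRat, gamma, partialD_rat_zero hp, partialD_rat_one hp,
      partialD_rat_two hp, rat, ← hx, ← hy] at hF ⊢ <;> (try field_simp) <;>
    (try simp only [factor]) <;> ring

-- The two coefficients encode the sectional curvatures: `4m - 3l²/4` on horizontal planes and
-- `l²/4` on planes containing `V = ∂_z`. Their difference `4m - l²` measures the failure of
-- constant curvature. The indicator of `a = 2` is the `a`-th component of `V`.
set_option maxHeartbeats 2000000 in
theorem curvature_metric (l : ℝ) (hp : p ∈ space m) (a b c d : Fin 3) :
    curvature (metric m l) a b c d p =
      (4 * m - 3 * l ^ 2 / 4) * (metricRat m l d b p * (if a = c then 1 else 0)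
        - metricRat m l c b p * (if a = d then 1 else 0))
      - (4 * m - l ^ 2) * (form m l p d * form m l p b * (if a = c then 1 else 0)
        - form m l p c * form m l p b * (if a = d then 1 else 0)
        + metricRat m l d b p * form m l p c * (if a = 2 then 1 else 0)
        - metricRat m l c b p * form m l p d * (if a = 2 then 1 else 0)) := by
  have hF : factor m (p 0) (p 1) ≠ 0 := ne_of_gt hp
  have hd : ∀ i k j r, partialD i (christoffel (metric m l) k j r) p
      = partialD i (gamma m l k j r) p :=
    fun i k j r => partialD_congr (isOpen_space m) hp
      (fun q hq => christoffel_metric l hq k j r) i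
  simp only [curvature, hd, christoffel_metric l hp, Fin.sum_univ_three]
  obtain ⟨y, hy⟩ : ∃ y, y = p 1 := ⟨_, rfl⟩
  obtain ⟨x, hx⟩ : ∃ x, x = p 0 := ⟨_, rfl⟩
  fin_cases a <;> fin_cases b <;> fin_cases c <;> fin_cases d <;>
    simp [metricRat, gamma, partialD_rat_zero hp, partialD_rat_one hp, form,
      partialD_rat_two hp, rat, ← hx, ← hy] at hF ⊢ <;> (try field_simp) <;>
    (try simp only [factor]) <;> ring

end

theorem partialD_apply_eq_of_hasDerivAt {n k : ℕ} {F : (Fin n → ℝ) → Fin k → ℝ} {p : Fin n → ℝ}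
    {i : Fin n} {a : Fin k} {d : ℝ} (h : DifferentiableAt ℝ F p)
    (hd : HasDerivAt (fun t => F (Function.update p i t) a) d (p i)) : partialD i F p a = d :=
  (hasDerivAt_pi.1 (hasDerivAt_partialD i h) a).unique hd

theorem curvatureOp_metric {m : ℝ} {p : Fin 3 → ℝ} (l : ℝ) (hp : p ∈ space m)
    (X Y Z : Fin 3 → ℝ) :
    curvatureOp (metric m l) p X Y Z =
      (4 * m - 3 * l ^ 2 / 4) • ((Y ⬝ᵥ (metric m l p *ᵥ Z)) • X - (X ⬝ᵥ (metric m l p *ᵥ Z)) • Y)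
      - (4 * m - l ^ 2) • (((form m l p ⬝ᵥ Y) * (form m l p ⬝ᵥ Z)) • X
        - ((form m l p ⬝ᵥ X) * (form m l p ⬝ᵥ Z)) • Y
        + ((Y ⬝ᵥ (metric m l p *ᵥ Z)) * (form m l p ⬝ᵥ X)
          - (X ⬝ᵥ (metric m l p *ᵥ Z)) * (form m l p ⬝ᵥ Y)) • ![0, 0, 1]) := by
  ext a
  simp only [curvatureOp, curvature_metric l hp, ← metric_apply l hp]
  generalize metric m l p = h
  generalize form m l p = η
  simp only [Pi.sub_apply, Pi.add_apply, Pi.smul_apply, smul_eq_mul, Fin.sum_univ_three, dotProduct,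
    Matrix.mulVec]
  fin_cases a <;> simp <;> ring

/-! ### The adapted frame and covariant derivatives along the cylinder -/

/-- The vector `A X + B ξ + C V` in coordinates, where `X = c E₁ + s E₂`, `ξ = -s E₁ + c E₂`, `V`
is the orthonormal frame at a point over `(x, y)`. -/
def frameVec (m l x y c s A B C : ℝ) : Fin 3 → ℝ :=
  ![factor m x y * (A * c - B * s), factor m x y * (A * s + B * c),
    -(l / 2 * (y * c - x * s)) * A + l / 2 * (y * s + x * c) * B + C]

/-- The geodesic curvature of a curve of unit speed with tangent `c E₁ + s E₂`, where
`w = c s' - s c'`. -/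
def curv (m : ℝ) (γ : ℝ → Fin 2 → ℝ) (c s w : ℝ → ℝ) (t : ℝ) : ℝ :=
  w t + 2 * m * (c t * γ t 1 - γ t 0 * s t)

/-- A curve `γ` of unit speed with tangent `c E₁ + s E₂`. -/
structure IsFramedCurve (m : ℝ) (I : Set ℝ) (γ : ℝ → Fin 2 → ℝ) (c s w : ℝ → ℝ) : Prop where
  isOpen : IsOpen I
  pos : ∀ t ∈ I, 0 < factor m (γ t 0) (γ t 1)
  deriv_x : ∀ t ∈ I, HasDerivAt (fun t => γ t 0) (factor m (γ t 0) (γ t 1) * c t) t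
  deriv_y : ∀ t ∈ I, HasDerivAt (fun t => γ t 1) (factor m (γ t 0) (γ t 1) * s t) t
  deriv_c : ∀ t ∈ I, HasDerivAt c (-(s t * w t)) t
  deriv_s : ∀ t ∈ I, HasDerivAt s (c t * w t) t
  norm_eq : ∀ t ∈ I, c t ^ 2 + s t ^ 2 = 1
  smooth : ContDiffOn ℝ ∞ (curv m γ c s w) I

namespace IsFramedCurve
variable {m : ℝ} {I : Set ℝ} {γ : ℝ → Fin 2 → ℝ} {c s w : ℝ → ℝ}

theorem deriv_factor (h : IsFramedCurve m I γ c s w) {t : ℝ} (ht : t ∈ I) :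
    HasDerivAt (fun t => factor m (γ t 0) (γ t 1))
      (2 * m * factor m (γ t 0) (γ t 1) * (γ t 0 * c t + γ t 1 * s t)) t := by
  have h1 := ((((h.deriv_x t ht).fun_pow 2).add ((h.deriv_y t ht).fun_pow 2)).const_mul m).const_add 1
  refine h1.congr_deriv ?_
  push_cast
  ring

theorem partialD_hopfCylinder (h : IsFramedCurve m I γ c s w) {p : Fin 2 → ℝ} (hp : p 0 ∈ I) :
    partialD 0 (hopfCylinder γ) p = ![factor m (γ (p 0) 0) (γ (p 0) 1) * c (p 0),
      factor m (γ (p 0) 0) (γ (p 0) 1) * s (p 0), 0] ∧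
    partialD 1 (hopfCylinder γ) p = ![0, 0, 1] := by
  have hd : DifferentiableAt ℝ (hopfCylinder γ) p := by
    have hc : DifferentiableAt ℝ (fun q : Fin 2 → ℝ => q 0) p := by fun_prop
    rw [differentiableAt_pi]
    intro a
    fin_cases a
    · exact (h.deriv_x _ hp).differentiableAt.comp (f := fun q : Fin 2 → ℝ => q 0) p hc
    · exact (h.deriv_y _ hp).differentiableAt.comp (f := fun q : Fin 2 → ℝ => q 0) p hc
    · simp [hopfCylinder]; fun_prop
  constructor
  · refine partialD_eq_of_hasDerivAt hd ?_
    rw [hasDerivAt_pi]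
    intro a
    fin_cases a
    · simpa [hopfCylinder] using h.deriv_x _ hp
    · simpa [hopfCylinder] using h.deriv_y _ hp
    · simpa [hopfCylinder] using hasDerivAt_const (p 0) (p 1)
  · refine partialD_eq_of_hasDerivAt hd ?_
    rw [hasDerivAt_pi]
    intro a
    fin_cases a
    · simpa [hopfCylinder] using hasDerivAt_const (p 1) (γ (p 0) 0)
    · simpa [hopfCylinder] using hasDerivAt_const (p 1) (γ (p 0) 1)
    · simpa [hopfCylinder] using hasDerivAt_id' (p 1)

/-- A field along the Hopf cylinder, in terms of the frame. -/
def field (m l : ℝ) (γ : ℝ → Fin 2 → ℝ) (c s : ℝ → ℝ) (A B C : (Fin 2 → ℝ) → ℝ)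
    (q : Fin 2 → ℝ) : Fin 3 → ℝ :=
  frameVec m l (γ (q 0) 0) (γ (q 0) 1) (c (q 0)) (s (q 0)) (A q) (B q) (C q)

variable {p : Fin 2 → ℝ} {A B C : (Fin 2 → ℝ) → ℝ}

theorem differentiableAt_field (h : IsFramedCurve m I γ c s w) (l : ℝ) (hp : p 0 ∈ I)
    (hA : DifferentiableAt ℝ A p) (hB : DifferentiableAt ℝ B p) (hC : DifferentiableAt ℝ C p) :
    DifferentiableAt ℝ (field m l γ c s A B C) p := by
  have hc : DifferentiableAt ℝ (fun q : Fin 2 → ℝ => q 0) p := by fun_prop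
  have h1 : DifferentiableAt ℝ (fun q : Fin 2 → ℝ => γ (q 0) 0) p :=
    (h.deriv_x _ hp).differentiableAt.comp (f := fun q : Fin 2 → ℝ => q 0) p hc
  have h2 : DifferentiableAt ℝ (fun q : Fin 2 → ℝ => γ (q 0) 1) p :=
    (h.deriv_y _ hp).differentiableAt.comp (f := fun q : Fin 2 → ℝ => q 0) p hc
  have h3 : DifferentiableAt ℝ (fun q : Fin 2 → ℝ => c (q 0)) p :=
    (h.deriv_c _ hp).differentiableAt.comp (f := fun q : Fin 2 → ℝ => q 0) p hc
  have h4 : DifferentiableAt ℝ (fun q : Fin 2 → ℝ => s (q 0)) p :=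
    (h.deriv_s _ hp).differentiableAt.comp (f := fun q : Fin 2 → ℝ => q 0) p hc
  have key : ∀ X Y P Q : (Fin 2 → ℝ) → ℝ, DifferentiableAt ℝ X p → DifferentiableAt ℝ Y p →
      DifferentiableAt ℝ P p → DifferentiableAt ℝ Q p → DifferentiableAt ℝ
        (fun q => frameVec m l (X q) (Y q) (P q) (Q q) (A q) (B q) (C q)) p := by
    intro X Y P Q hX hY hP hQ
    rw [differentiableAt_pi]
    intro a
    fin_cases a <;> simp [frameVec, factor] <;> fun_prop
  exact key _ _ _ _ h1 h2 h3 h4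

/-- This is the Leibniz rule for `∂ₛφ = X + θV` with the structure equations `∇_X X = κξ`, `∇_X ξ =
-κX + (l/2)V`, `∇_X V = -(l/2)ξ`, `∇_V X = -(l/2)ξ`, `∇_V ξ = (l/2)X`, `∇_V V = 0`. -/
theorem pullbackD_field_zero (h : IsFramedCurve m I γ c s w) (l : ℝ) (hp : p 0 ∈ I)
    (hA : DifferentiableAt ℝ A p) (hB : DifferentiableAt ℝ B p) (hC : DifferentiableAt ℝ C p)
    {x y c₀ s₀ κ θ : ℝ} (hx : γ (p 0) 0 = x) (hy : γ (p 0) 1 = y) (hc : c (p 0) = c₀)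
    (hs : s (p 0) = s₀) (hκ : κ = w (p 0) + 2 * m * (c₀ * y - x * s₀))
    (hθ : θ = l / 2 * (y * c₀ - x * s₀)) :
    pullbackD (metric m l) (hopfCylinder γ) 0 (field m l γ c s A B C) p =
      frameVec m l x y c₀ s₀ (partialD 0 A p - κ * B p + l / 2 * θ * B p)
        (partialD 0 B p + κ * A p - l / 2 * C p - l / 2 * θ * A p)
        (partialD 0 C p + l / 2 * B p) := by
  have hF := h.pos _ hp
  have hcs := h.norm_eq _ hp
  have hA' := hasDerivAt_partialD 0 hA
  have hB' := hasDerivAt_partialD 0 hB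
  have hC' := hasDerivAt_partialD 0 hC
  have dx := h.deriv_x _ hp
  have dy := h.deriv_y _ hp
  have dc := h.deriv_c _ hp
  have ds := h.deriv_s _ hp
  have dF := h.deriv_factor hp
  have hsp : hopfCylinder γ p ∈ space m := by simpa [space, hopfCylinder] using hF
  have hW := h.differentiableAt_field l hp hA hB hC
  have e0 := partialD_apply_eq_of_hasDerivAt (i := 0) (a := 0) hW
    (dF.fun_mul ((hA'.fun_mul dc).fun_sub (hB'.fun_mul ds)))
  have e1 := partialD_apply_eq_of_hasDerivAt (i := 0) (a := 1) hW
    (dF.fun_mul ((hA'.fun_mul ds).fun_add (hB'.fun_mul dc)))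
  have e2 := partialD_apply_eq_of_hasDerivAt (i := 0) (a := 2) hW
    ((((((dy.fun_mul dc).fun_sub (dx.fun_mul ds)).const_mul (l / 2)).fun_neg.fun_mul hA').fun_add
        ((((dy.fun_mul ds).fun_add (dx.fun_mul dc)).const_mul (l / 2)).fun_mul hB')).fun_add hC')
  have hF0 := hF.ne'
  simp only [Function.update_eq_self, hx, hy, hc, hs] at e0 e1 e2 hF0 hcs
  subst hκ hθ
  -- `F` becomes an atom so that denominators can be cleared; its definition and `c² + s² = 1` are
  -- kept as relations for the final polynomial identities.
  obtain ⟨F, hFF⟩ : ∃ F, factor m x y = F := ⟨_, rfl⟩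
  have hFx := hFF
  unfold factor at hFx
  ext a
  simp only [pullbackD, (h.partialD_hopfCylinder hp).1, christoffel_metric l hsp,
    Fin.sum_univ_three, field, hx, hy, hc, hs]
  clear hA' hB' hC' hsp hW hF dx dy dc ds dF h hA hB hC
  generalize w (p 0) = w₀ at *
  generalize A p = A₀ at *
  generalize B p = B₀ at *
  generalize C p = C₀ at *
  generalize partialD 0 A p = A₁ at *
  generalize partialD 0 B p = B₁ at *
  generalize partialD 0 C p = C₁ at *
  fin_cases a <;>
    simp [gamma, rat, hopfCylinder, frameVec, hx, hy, e0, e1, e2, hFF] <;>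
    rw [hFF] at hF0 <;> clear hx hy hc hs e0 e1 e2 hFF <;> field_simp
  · grind
  · grind
  · grind

theorem pullbackD_field_one (h : IsFramedCurve m I γ c s w) (l : ℝ) (hp : p 0 ∈ I)
    (hA : DifferentiableAt ℝ A p) (hB : DifferentiableAt ℝ B p) (hC : DifferentiableAt ℝ C p)
    {x y c₀ s₀ : ℝ} (hx : γ (p 0) 0 = x) (hy : γ (p 0) 1 = y) (hc : c (p 0) = c₀)
    (hs : s (p 0) = s₀) :
    pullbackD (metric m l) (hopfCylinder γ) 1 (field m l γ c s A B C) p =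
      frameVec m l x y c₀ s₀ (partialD 1 A p + l / 2 * B p) (partialD 1 B p - l / 2 * A p)
        (partialD 1 C p) := by
  have hF := h.pos _ hp
  have hA' := hasDerivAt_partialD 1 hA
  have hB' := hasDerivAt_partialD 1 hB
  have hC' := hasDerivAt_partialD 1 hC
  have hsp : hopfCylinder γ p ∈ space m := by simpa [space, hopfCylinder] using hF
  have hW := h.differentiableAt_field l hp hA hB hC
  have e0 := partialD_apply_eq_of_hasDerivAt (i := 1) (a := 0) hW
    (((hA'.mul_const (c (p 0))).fun_sub (hB'.mul_const (s (p 0)))).const_mul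
      (factor m (γ (p 0) 0) (γ (p 0) 1)))
  have e1 := partialD_apply_eq_of_hasDerivAt (i := 1) (a := 1) hW
    (((hA'.mul_const (s (p 0))).fun_add (hB'.mul_const (c (p 0)))).const_mul
      (factor m (γ (p 0) 0) (γ (p 0) 1)))
  have e2 := partialD_apply_eq_of_hasDerivAt (i := 1) (a := 2) hW
    (((hA'.const_mul (-(l / 2 * (γ (p 0) 1 * c (p 0) - γ (p 0) 0 * s (p 0))))).fun_add
      (hB'.const_mul (l / 2 * (γ (p 0) 1 * s (p 0) + γ (p 0) 0 * c (p 0))))).fun_add hC')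
  have hF0 := hF.ne'
  simp only [hx, hy, hc, hs] at e0 e1 e2 hF0
  ext a
  simp only [pullbackD, (h.partialD_hopfCylinder hp).2, christoffel_metric l hsp,
    Fin.sum_univ_three, field, hx, hy, hc, hs]
  fin_cases a <;>
    simp [gamma, rat, hopfCylinder, frameVec, hx, hy, e0, e1, e2] <;> field_simp <;> ring

end IsFramedCurve

/-! ### Traces with respect to the conformal metric -/

theorem pullbackD_congr {k n : ℕ} {h : (Fin n → ℝ) → Matrix (Fin n) (Fin n) ℝ}
    {φ : (Fin k → ℝ) → (Fin n → ℝ)} {W W' : (Fin k → ℝ) → (Fin n → ℝ)} {U : Set (Fin k → ℝ)}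
    {p : Fin k → ℝ} (hU : IsOpen U) (hp : p ∈ U) (hW : ∀ q ∈ U, W q = W' q) (i : Fin k) :
    pullbackD h φ i W p = pullbackD h φ i W' p := by
  funext a
  simp only [pullbackD, partialD_congr hU hp hW i, hW p hp]

/-- The trace of a tensor of the form `T i j - Γ r i j P r` with respect to a metric conformal to
`(1 + θ²) ds² + 2 θ ds dz + dz²`, where `θ` depends on `s` only. -/
theorem trace_conformal {n : ℕ} {g : (Fin 2 → ℝ) → Matrix (Fin 2) (Fin 2) ℝ}
    {f : (Fin 2 → ℝ) → ℝ} {th : ℝ → ℝ} {th' : ℝ} {U : Set (Fin 2 → ℝ)} {p : Fin 2 → ℝ}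
    (hU : IsOpen U) (hp : p ∈ U)
    (hg : ∀ q ∈ U, g q = (f q)⁻¹ • !![1 + th (q 0) ^ 2, th (q 0); th (q 0), 1])
    (hf : DifferentiableAt ℝ f p) (hf0 : f p ≠ 0) (hth : HasDerivAt th th' (p 0))
    (T : Fin 2 → Fin 2 → Fin n → ℝ) (P : Fin 2 → Fin n → ℝ) :
    ∑ i, ∑ j, (g p)⁻¹ i j • (T i j - ∑ r, christoffel g r i j p • P r) =
      f p • (T 0 0 - th (p 0) • (T 0 1 + T 1 0) + (1 + th (p 0) ^ 2) • T 1 1 - th' • P 1) := by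
  -- The matrix multiplying `(f p)⁻¹` has determinant one, so its inverse is its adjugate.
  have hinv : (g p)⁻¹ = f p • !![1, -th (p 0); -th (p 0), 1 + th (p 0) ^ 2] := by
    refine Matrix.inv_eq_right_inv ?_
    rw [hg p hp]
    ext i j
    fin_cases i <;> fin_cases j <;> simp [Matrix.mul_apply, Fin.sum_univ_two] <;> field_simp <;>
      ring
  -- In terms of `v = 1/f` the metric is linear in `v`. The derivatives of `v` cancel in the traced
  -- Christoffel symbols because the surface has dimension two; only `θ'` survives.
  obtain ⟨v, hv⟩ : ∃ v : (Fin 2 → ℝ) → ℝ, v = fun q => (f q)⁻¹ := ⟨_, rfl⟩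
  have hvd : DifferentiableAt ℝ v p := hv ▸ hf.inv hf0
  have v0 := hasDerivAt_partialD 0 hvd
  have v1 := hasDerivAt_partialD 1 hvd
  have hvp : v p = (f p)⁻¹ := by rw [hv]
  have hthc : DifferentiableAt ℝ (fun q : Fin 2 → ℝ => th (q 0)) p :=
    hth.differentiableAt.comp (f := fun q : Fin 2 → ℝ => q 0) p (by fun_prop)
  have hd1 : DifferentiableAt ℝ (fun q => v q * th (q 0)) p := hvd.fun_mul hthc
  have hd2 : DifferentiableAt ℝ (fun q => v q * (1 + th (q 0) ^ 2)) p :=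
    hvd.fun_mul ((hthc.fun_pow 2).const_add 1)
  have e00 : ∀ q ∈ U, g q 0 0 = v q * (1 + th (q 0) ^ 2) := fun q hq => by simp [hg q hq, hv]
  have e01 : ∀ q ∈ U, g q 0 1 = v q * th (q 0) := fun q hq => by simp [hg q hq, hv]
  have e10 : ∀ q ∈ U, g q 1 0 = v q * th (q 0) := fun q hq => by simp [hg q hq, hv]
  have e11 : ∀ q ∈ U, g q 1 1 = v q := fun q hq => by simp [hg q hq, hv]
  have d0 : partialD 0 (fun q => v q * (1 + th (q 0) ^ 2)) p =
      partialD 0 v p * (1 + th (p 0) ^ 2) + v p * (2 * th (p 0) * th') := by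
    refine partialD_eq_of_hasDerivAt hd2 ?_
    have := v0.fun_mul ((hth.fun_pow 2).const_add 1)
    simp only [Function.update_eq_self, Function.update_self] at this ⊢
    refine this.congr_deriv ?_
    push_cast; ring
  have d1 : partialD 0 (fun q => v q * th (q 0)) p =
      partialD 0 v p * th (p 0) + v p * th' := by
    refine partialD_eq_of_hasDerivAt hd1 ?_
    have := v0.fun_mul hth
    simpa only [Function.update_eq_self, Function.update_self] using this
  have d2 : partialD 1 (fun q => v q * (1 + th (q 0) ^ 2)) p =
      partialD 1 v p * (1 + th (p 0) ^ 2) :=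
    partialD_eq_of_hasDerivAt hd2 (v1.mul_const (1 + th (p 0) ^ 2))
  have d3 : partialD 1 (fun q => v q * th (q 0)) p = partialD 1 v p * th (p 0) :=
    partialD_eq_of_hasDerivAt hd1 (v1.mul_const (th (p 0)))
  have k00 := fun i => partialD_congr hU hp e00 i
  have k01 := fun i => partialD_congr hU hp e01 i
  have k10 := fun i => partialD_congr hU hp e10 i
  have k11 := fun i => partialD_congr hU hp e11 i
  ext a
  simp only [christoffel, Fin.sum_univ_two, k00, k01, k10, k11, d0, d1, d2, d3, hinv, hvp,
    Pi.add_apply, Pi.sub_apply, Pi.smul_apply, smul_eq_mul]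
  simp
  field_simp
  ring

/-- The frame is linearly independent, so a vanishing vector equation splits into three scalar
equations. -/
theorem frameVec_eq_zero {m l x y c s A B C : ℝ} (hF : factor m x y ≠ 0) (hcs : c ^ 2 + s ^ 2 = 1)
    (h : frameVec m l x y c s A B C = 0) : A = 0 ∧ B = 0 ∧ C = 0 := by
  have h0 := congrFun h 0
  have h1 := congrFun h 1
  have h2 := congrFun h 2
  simp [frameVec, hF] at h0 h1 h2
  have hA : A = 0 := by linear_combination c * h0 + s * h1 - A * hcs
  have hB : B = 0 := by linear_combination c * h1 - s * h0 - B * hcs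
  refine ⟨hA, hB, ?_⟩
  simpa [hA, hB] using h2

/-! ### The tension field and the curvature term -/

namespace IsFramedCurve
variable {m : ℝ} {I : Set ℝ} {γ : ℝ → Fin 2 → ℝ} {c s w : ℝ → ℝ} {p : Fin 2 → ℝ}

/-- The contact form on the tangent vector of the curve. -/
def tilt (l : ℝ) (γ : ℝ → Fin 2 → ℝ) (c s : ℝ → ℝ) (t : ℝ) : ℝ :=
  l / 2 * (γ t 1 * c t - γ t 0 * s t)

theorem deriv_tilt (h : IsFramedCurve m I γ c s w) (l : ℝ) {t : ℝ} (ht : t ∈ I) :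
    HasDerivAt (tilt l γ c s) (-(l / 2 * w t * (γ t 1 * s t + γ t 0 * c t))) t := by
  have := (((h.deriv_y t ht).fun_mul (h.deriv_c t ht)).fun_sub
    ((h.deriv_x t ht).fun_mul (h.deriv_s t ht))).const_mul (l / 2)
  exact this.congr_deriv (by ring)

theorem pullbackMetric_hopfCylinder (h : IsFramedCurve m I γ c s w) (l : ℝ) (hp : p 0 ∈ I) :
    pullbackMetric (metric m l) (hopfCylinder γ) p =
      !![1 + tilt l γ c s (p 0) ^ 2, tilt l γ c s (p 0); tilt l γ c s (p 0), 1] := by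
  have hF := (h.pos _ hp).ne'
  have hcs := h.norm_eq _ hp
  ext i j
  fin_cases i <;> fin_cases j <;>
    simp [pullbackMetric, (h.partialD_hopfCylinder hp).1, (h.partialD_hopfCylinder hp).2, metric,
      form, hopfCylinder, Matrix.mulVec, dotProduct, Fin.sum_univ_three, tilt] <;>
    field_simp
  · linear_combination 4 * hcs
  · ring
  · ring

theorem partialD_hopfCylinder_zero (h : IsFramedCurve m I γ c s w) (l : ℝ) (hp : p 0 ∈ I) :
    partialD 0 (hopfCylinder γ) p =
      field m l γ c s (fun _ => 1) (fun _ => 0) (fun q => tilt l γ c s (q 0)) p := by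
  rw [(h.partialD_hopfCylinder hp).1]
  ext a
  fin_cases a <;> simp [field, frameVec, tilt]

theorem partialD_hopfCylinder_one (h : IsFramedCurve m I γ c s w) (l : ℝ) (hp : p 0 ∈ I) :
    partialD 1 (hopfCylinder γ) p =
      field m l γ c s (fun _ => 0) (fun _ => 0) (fun _ => 1) p := by
  rw [(h.partialD_hopfCylinder hp).2]
  ext a
  fin_cases a <;> simp [field, frameVec]

theorem partialD_comp_zero {φ : ℝ → ℝ} {d : ℝ} (h : HasDerivAt φ d (p 0)) :
    DifferentiableAt ℝ (fun q : Fin 2 → ℝ => φ (q 0)) p ∧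
    partialD 0 (fun q : Fin 2 → ℝ => φ (q 0)) p = d ∧
    partialD 1 (fun q : Fin 2 → ℝ => φ (q 0)) p = 0 := by
  have hd : DifferentiableAt ℝ (fun q : Fin 2 → ℝ => φ (q 0)) p :=
    h.differentiableAt.comp (f := fun q : Fin 2 → ℝ => q 0) p (by fun_prop)
  refine ⟨hd, partialD_eq_of_hasDerivAt hd ?_, partialD_eq_of_hasDerivAt hd ?_⟩
  · simpa using h
  · simpa using hasDerivAt_const (p 1) (φ (p 0))

theorem partialD_const (i : Fin 2) (a : ℝ) : partialD i (fun _ : Fin 2 → ℝ => a) p = 0 := by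
  simp [partialD]

/-- In the trace, `θ'` and the `θl` terms cancel: the fibres are geodesics, so the mean curvature
comes from `∇_X X = κξ` alone. -/
theorem tension_hopfCylinder (h : IsFramedCurve m I γ c s w) (l : ℝ) {U : Set (Fin 2 → ℝ)}
    {f : (Fin 2 → ℝ) → ℝ} (hU : IsOpen U) (hUI : ∀ q ∈ U, q 0 ∈ I)
    (hf : ∀ q ∈ U, DifferentiableAt ℝ f q) (hf0 : ∀ q ∈ U, f q ≠ 0) (hp : p ∈ U) :
    tension (fun p => (f p)⁻¹ • pullbackMetric (metric m l) (hopfCylinder γ) p) (metric m l)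
      (hopfCylinder γ) p =
      field m l γ c s (fun _ => 0) (fun q => f q * curv m γ c s w (q 0)) (fun _ => 0) p := by
  have hpI := hUI p hp
  have hg := fun q hq => congrArg ((f q)⁻¹ • ·) (h.pullbackMetric_hopfCylinder l (hUI q hq))
  obtain ⟨ht, ht0, ht1⟩ := partialD_comp_zero (h.deriv_tilt l hpI)
  rw [tension, trace_conformal hU hp hg (hf p hp) (hf0 p hp) (h.deriv_tilt l hpI)
    (fun i j => pullbackD (metric m l) (hopfCylinder γ) i (partialD j (hopfCylinder γ)) p)
    (fun r => partialD r (hopfCylinder γ) p)]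
  have c0 := fun i => pullbackD_congr (h := metric m l) (φ := hopfCylinder γ) hU hp
    (fun q hq => h.partialD_hopfCylinder_zero l (hUI q hq)) i
  have c1 := fun i => pullbackD_congr (h := metric m l) (φ := hopfCylinder γ) hU hp
    (fun q hq => h.partialD_hopfCylinder_one l (hUI q hq)) i
  have k : ∀ a : ℝ, DifferentiableAt ℝ (fun _ : Fin 2 → ℝ => a) p := fun a => by fun_prop
  simp only [c0, c1, h.pullbackD_field_zero l hpI (k 1) (k 0) ht rfl rfl rfl rfl rfl rfl,
    h.pullbackD_field_zero l hpI (k 0) (k 0) (k 1) rfl rfl rfl rfl rfl rfl,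
    h.pullbackD_field_one l hpI (k 1) (k 0) ht rfl rfl rfl rfl,
    h.pullbackD_field_one l hpI (k 0) (k 0) (k 1) rfl rfl rfl rfl, ht0, ht1, partialD_const,
    (h.partialD_hopfCylinder hpI).2]
  ext a
  simp only [Pi.add_apply, Pi.sub_apply, Pi.smul_apply, smul_eq_mul, field]
  fin_cases a <;> simp [frameVec, tilt, curv] <;> ring

/-- Since `ξ` is orthogonal to both coordinate tangent vectors and to `V`, only the terms of
`curvatureOp_metric` proportional to `ξ` remain. -/
theorem curvatureOp_hopfCylinder (h : IsFramedCurve m I γ c s w) (l u : ℝ) (hp : p 0 ∈ I)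
    (i j : Fin 2) :
    curvatureOp (metric m l) (hopfCylinder γ p) (partialD i (hopfCylinder γ) p)
      (frameVec m l (γ (p 0) 0) (γ (p 0) 1) (c (p 0)) (s (p 0)) 0 u 0)
      (partialD j (hopfCylinder γ) p) =
    frameVec m l (γ (p 0) 0) (γ (p 0) 1) (c (p 0)) (s (p 0)) 0
      ((-(4 * m - 3 * l ^ 2 / 4) *
        (!![1 + tilt l γ c s (p 0) ^ 2, tilt l γ c s (p 0); tilt l γ c s (p 0), 1] i j)
        + (4 * m - l ^ 2) * (![tilt l γ c s (p 0), 1] i * ![tilt l γ c s (p 0), 1] j)) * u) 0 := by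
  have hF := h.pos _ hp
  have hsp : hopfCylinder γ p ∈ space m := by simpa [space, hopfCylinder] using hF
  have hF0 := hF.ne'
  have hG : partialD i (hopfCylinder γ) p ⬝ᵥ
      (metric m l (hopfCylinder γ p) *ᵥ partialD j (hopfCylinder γ) p) =
      !![1 + tilt l γ c s (p 0) ^ 2, tilt l γ c s (p 0); tilt l γ c s (p 0), 1] i j :=
    congrFun (congrFun (h.pullbackMetric_hopfCylinder l hp) i) j
  have hη : ∀ i, form m l (hopfCylinder γ p) ⬝ᵥ partialD i (hopfCylinder γ) p =
      ![tilt l γ c s (p 0), 1] i := by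
    intro i
    fin_cases i <;>
      simp [(h.partialD_hopfCylinder hp).1, (h.partialD_hopfCylinder hp).2, form, hopfCylinder,
        dotProduct, Fin.sum_univ_three, tilt]
    field_simp
    ring
  have hηξ : form m l (hopfCylinder γ p) ⬝ᵥ
      frameVec m l (γ (p 0) 0) (γ (p 0) 1) (c (p 0)) (s (p 0)) 0 u 0 = 0 := by
    simp [form, hopfCylinder, dotProduct, Fin.sum_univ_three, frameVec]
    field_simp
    ring
  have hξ : frameVec m l (γ (p 0) 0) (γ (p 0) 1) (c (p 0)) (s (p 0)) 0 u 0 ⬝ᵥ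
      (metric m l (hopfCylinder γ p) *ᵥ partialD j (hopfCylinder γ) p) = 0 := by
    fin_cases j <;>
      simp [(h.partialD_hopfCylinder hp).1, (h.partialD_hopfCylinder hp).2, metric,
        form, hopfCylinder, Matrix.mulVec, dotProduct, Fin.sum_univ_three, frameVec] <;>
      field_simp <;> ring
  rw [curvatureOp_metric l hsp, hG, hξ, hηξ, hη, hη]
  ext a
  simp only [Pi.add_apply, Pi.sub_apply, Pi.smul_apply, smul_eq_mul]
  fin_cases a <;> simp [frameVec] <;> ring

end IsFramedCurve

/-! ### Smoothness and symmetry of second derivatives -/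

theorem contDiffOn_partialD {n : ℕ} {u : (Fin n → ℝ) → ℝ} {U : Set (Fin n → ℝ)} (hU : IsOpen U)
    (hu : ContDiffOn ℝ ∞ u U) (i : Fin n) : ContDiffOn ℝ ∞ (partialD i u) U :=
  (hu.fderiv_of_isOpen hU (m := ∞) (by simp)).clm_apply contDiffOn_const

theorem differentiableAt_of_contDiffOn {E : Type*} [NormedAddCommGroup E] [NormedSpace ℝ E]
    {G : Type*} [NormedAddCommGroup G] [NormedSpace ℝ G] {u : E → G} {U : Set E} {p : E} (hU : IsOpen U)
    (hu : ContDiffOn ℝ ∞ u U) (hp : p ∈ U) : DifferentiableAt ℝ u p :=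
  (hu.contDiffAt (hU.mem_nhds hp)).differentiableAt (by simp)

theorem partialD_comm {n : ℕ} {u : (Fin n → ℝ) → ℝ} {U : Set (Fin n → ℝ)} {p : Fin n → ℝ}
    (hU : IsOpen U) (hu : ContDiffOn ℝ ∞ u U) (hp : p ∈ U) (i j : Fin n) :
    partialD i (partialD j u) p = partialD j (partialD i u) p := by
  have hc := hu.contDiffAt (hU.mem_nhds hp)
  have hs : IsSymmSndFDerivAt ℝ u p := hc.isSymmSndFDerivAt (by
    rw [minSmoothness_of_isRCLikeNormedField]
    exact WithTop.coe_le_coe.2 (le_top : (2 : ℕ∞) ≤ ⊤))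
  have hd : DifferentiableAt ℝ (fderiv ℝ u) p :=
    ((hu.fderiv_of_isOpen hU (m := ∞) (by simp)).contDiffAt (hU.mem_nhds hp)).differentiableAt
      (by simp)
  have key : ∀ i j : Fin n, partialD i (partialD j u) p =
      fderiv ℝ (fderiv ℝ u) p (Pi.single i 1) (Pi.single j 1) := by
    intro i j
    unfold partialD
    rw [fderiv_clm_apply hd (by fun_prop)]
    simp
  rw [key, key, hs.eq]

/-! ### The bitension field -/

namespace IsFramedCurve
variable {m : ℝ} {I : Set ℝ} {γ : ℝ → Fin 2 → ℝ} {c s w : ℝ → ℝ} {p : Fin 2 → ℝ}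

/-- Differentiating `uξ` twice with the structure equations separates the frame components. The
conformal factor appears only through `u` and the overall `f p`, and the curvature affects only the
`ξ`-component. -/
theorem bitension_hopfCylinder (h : IsFramedCurve m I γ c s w) (l : ℝ) {U : Set (Fin 2 → ℝ)}
    {f u : (Fin 2 → ℝ) → ℝ} (hU : IsOpen U) (hUI : ∀ q ∈ U, q 0 ∈ I)
    (hf : ∀ q ∈ U, DifferentiableAt ℝ f q) (hf0 : ∀ q ∈ U, f q ≠ 0)
    (hu : ContDiffOn ℝ ∞ u U) (huf : ∀ q, u q = f q * curv m γ c s w (q 0)) (hp : p ∈ U) :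
    bitension (fun p => (f p)⁻¹ • pullbackMetric (metric m l) (hopfCylinder γ) p) (metric m l)
      (hopfCylinder γ) p =
    f p • frameVec m l (γ (p 0) 0) (γ (p 0) 1) (c (p 0)) (s (p 0))
      (-(u p * deriv (curv m γ c s w) (p 0))
        - 2 * curv m γ c s w (p 0) * (partialD 0 u p - tilt l γ c s (p 0) * partialD 1 u p)
        + l * partialD 1 u p)
      (partialD 0 (partialD 0 u) p
        - tilt l γ c s (p 0) * (partialD 0 (partialD 1 u) p + partialD 1 (partialD 0 u) p)
        + (1 + tilt l γ c s (p 0) ^ 2) * partialD 1 (partialD 1 u) p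
        - deriv (tilt l γ c s) (p 0) * partialD 1 u p
        - u p * (curv m γ c s w (p 0) ^ 2 + l ^ 2 - 4 * m))
      (l * (partialD 0 u p - tilt l γ c s (p 0) * partialD 1 u p)) := by
  have hpI := hUI p hp
  have hg := fun q hq => congrArg ((f q)⁻¹ • ·) (h.pullbackMetric_hopfCylinder l (hUI q hq))
  have ht' := h.deriv_tilt l hpI
  obtain ⟨htd, ht0, ht1⟩ := partialD_comp_zero ht'
  have hκ' := (differentiableAt_of_contDiffOn h.isOpen h.smooth hpI).hasDerivAt
  obtain ⟨hκd, hκ0, hκ1⟩ := partialD_comp_zero hκ'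
  have hud : ∀ q ∈ U, DifferentiableAt ℝ u q := fun q hq => differentiableAt_of_contDiffOn hU hu hq
  have hu0d := differentiableAt_of_contDiffOn hU (contDiffOn_partialD hU hu 0) hp
  have hu1d := differentiableAt_of_contDiffOn hU (contDiffOn_partialD hU hu 1) hp
  have k : ∀ a : ℝ, ∀ q : Fin 2 → ℝ, DifferentiableAt ℝ (fun _ : Fin 2 → ℝ => a) q :=
    fun a q => by fun_prop
  have hτ : ∀ q ∈ U, tension (fun p => (f p)⁻¹ • pullbackMetric (metric m l) (hopfCylinder γ) p)
      (metric m l) (hopfCylinder γ) q = field m l γ c s (fun _ => 0) u (fun _ => 0) q := by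
    intro q hq
    rw [h.tension_hopfCylinder l hU hUI hf hf0 hq]
    simp only [field, huf]
  have D0 : ∀ q ∈ U, pullbackD (metric m l) (hopfCylinder γ) 0
      (tension (fun p => (f p)⁻¹ • pullbackMetric (metric m l) (hopfCylinder γ) p)
      (metric m l) (hopfCylinder γ)) q = field m l γ c s
        (fun q => u q * (l / 2 * tilt l γ c s (q 0) - curv m γ c s w (q 0)))
        (partialD 0 u) (fun q => l / 2 * u q) q := by
    intro q hq
    rw [pullbackD_congr hU hq hτ, h.pullbackD_field_zero l (hUI q hq) (k 0 q) (hud q hq) (k 0 q)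
      rfl rfl rfl rfl rfl rfl]
    simp only [partialD_const, field]
    congr 1 <;> simp [tilt, curv]
    ring
  have D1 : ∀ q ∈ U, pullbackD (metric m l) (hopfCylinder γ) 1
      (tension (fun p => (f p)⁻¹ • pullbackMetric (metric m l) (hopfCylinder γ) p)
      (metric m l) (hopfCylinder γ)) q = field m l γ c s
        (fun q => l / 2 * u q) (partialD 1 u) (fun _ => 0) q := by
    intro q hq
    rw [pullbackD_congr hU hq hτ, h.pullbackD_field_one l (hUI q hq) (k 0 q) (hud q hq) (k 0 q)
      rfl rfl rfl rfl]
    simp only [partialD_const, field]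
    congr 1 <;> simp
  have dlu : DifferentiableAt ℝ (fun q => l / 2 * u q) p := (hud p hp).const_mul _
  have dlu' : ∀ i, partialD i (fun q => l / 2 * u q) p = l / 2 * partialD i u p := fun i =>
    partialD_eq_of_hasDerivAt dlu ((hasDerivAt_partialD i (hud p hp)).const_mul _)
  have hd1 : DifferentiableAt ℝ
      (fun q : Fin 2 → ℝ => l / 2 * tilt l γ c s (q 0) - curv m γ c s w (q 0)) p :=
    (htd.const_mul _).fun_sub hκd
  have dA : DifferentiableAt ℝ
      (fun q => u q * (l / 2 * tilt l γ c s (q 0) - curv m γ c s w (q 0))) p :=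
    (hud p hp).fun_mul hd1
  have dA0 : partialD 0 (fun q => u q * (l / 2 * tilt l γ c s (q 0) - curv m γ c s w (q 0))) p =
      partialD 0 u p * (l / 2 * tilt l γ c s (p 0) - curv m γ c s w (p 0))
      + u p * (l / 2 * deriv (tilt l γ c s) (p 0) - deriv (curv m γ c s w) (p 0)) := by
    refine partialD_eq_of_hasDerivAt dA ?_
    have := (hasDerivAt_partialD 0 (hud p hp)).fun_mul
      ((ht'.const_mul (l / 2)).fun_sub hκ')
    simpa only [Function.update_eq_self, Function.update_self, ht'.deriv] using this
  have dA1 : partialD 1 (fun q => u q * (l / 2 * tilt l γ c s (q 0) - curv m γ c s w (q 0))) p =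
      partialD 1 u p * (l / 2 * tilt l γ c s (p 0) - curv m γ c s w (p 0)) :=
    partialD_eq_of_hasDerivAt dA ((hasDerivAt_partialD 1 (hud p hp)).mul_const
      (l / 2 * tilt l γ c s (p 0) - curv m γ c s w (p 0)))
  -- The curvature term is grouped with the second covariant derivative, giving the shape `T i j - Γ
  -- r i j P r` of `trace_conformal`.
  have hsub : ∀ P Q R : Fin 3 → ℝ, P - Q - R = P - R - Q := fun P Q R => by abel
  simp only [bitension, hsub]
  rw [trace_conformal hU hp hg (hf p hp) (hf0 p hp) ht'
    (fun i j => pullbackD (metric m l) (hopfCylinder γ) i (pullbackD (metric m l) (hopfCylinder γ) j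
      (tension (fun p => (f p)⁻¹ • pullbackMetric (metric m l) (hopfCylinder γ) p)
      (metric m l) (hopfCylinder γ))) p - curvatureOp (metric m l) (hopfCylinder γ p)
        (partialD i (hopfCylinder γ) p) (tension (fun p => (f p)⁻¹ • pullbackMetric (metric m l)
          (hopfCylinder γ) p) (metric m l) (hopfCylinder γ) p) (partialD j (hopfCylinder γ) p))
    (fun r => pullbackD (metric m l) (hopfCylinder γ) r
      (tension (fun p => (f p)⁻¹ • pullbackMetric (metric m l) (hopfCylinder γ) p)
      (metric m l) (hopfCylinder γ)) p)]
  simp only [hτ p hp, pullbackD_congr hU hp D0, pullbackD_congr hU hp D1, D1 p hp]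
  rw [h.pullbackD_field_zero l hpI dA hu0d dlu rfl rfl rfl rfl rfl rfl,
    h.pullbackD_field_zero l hpI dlu hu1d (k 0 p) rfl rfl rfl rfl rfl rfl,
    h.pullbackD_field_one l hpI dA hu0d dlu rfl rfl rfl rfl,
    h.pullbackD_field_one l hpI dlu hu1d (k 0 p) rfl rfl rfl rfl]
  simp only [field, h.curvatureOp_hopfCylinder l (u p) hpI, dA0, dA1, dlu', partialD_const,
    ht'.deriv]
  congr 1
  rw [show w (p 0) + 2 * m * (c (p 0) * γ (p 0) 1 - γ (p 0) 0 * s (p 0)) = curv m γ c s w (p 0)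
    from rfl]
  rw [show l / 2 * (γ (p 0) 1 * c (p 0) - γ (p 0) 0 * s (p 0)) = tilt l γ c s (p 0) from rfl]
  generalize tilt l γ c s (p 0) = θ
  generalize curv m γ c s w (p 0) = κ
  ext a
  simp only [Pi.add_apply, Pi.sub_apply, Pi.smul_apply, smul_eq_mul]
  fin_cases a <;> simp [frameVec] <;> ring

end IsFramedCurve

/-! ### Framing a unit-speed curve -/

/-- Take `c = x'/F`, `s = y'/F` and `w = cs' - sc'`. The latter is the derivative of the tangent
angle, so no angle function has to be chosen; the formulas for `c'` and `s'` follow from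
differentiating `c² + s² = 1`. -/
theorem IsUnitSpeedCurve.exists_isFramedCurve {m : ℝ} {I : Set ℝ} {γ : ℝ → Fin 2 → ℝ}
    (h : IsUnitSpeedCurve m I γ) : ∃ c s w : ℝ → ℝ, IsFramedCurve m I γ c s w := by
  have hsm : ∀ a, ContDiffOn ℝ ∞ (fun t => γ t a) I := contDiffOn_pi.1 h.smooth
  have hd : ∀ {φ : ℝ → ℝ}, ContDiffOn ℝ ∞ φ I → ContDiffOn ℝ ∞ (deriv φ) I := fun hφ =>
    hφ.deriv_of_isOpen h.isOpen (by simp)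
  have hD : ∀ {φ : ℝ → ℝ}, ContDiffOn ℝ ∞ φ I → ∀ t ∈ I, HasDerivAt φ (deriv φ t) t :=
    fun hφ t ht => (differentiableAt_of_contDiffOn h.isOpen hφ ht).hasDerivAt
  obtain ⟨F, hF⟩ : ∃ F : ℝ → ℝ, F = fun t => factor m (γ t 0) (γ t 1) := ⟨_, rfl⟩
  have hFsm : ContDiffOn ℝ ∞ F I := by
    rw [hF]
    exact contDiffOn_const.add (contDiffOn_const.mul (((hsm 0).pow 2).add ((hsm 1).pow 2)))
  have hF0 : ∀ t ∈ I, F t ≠ 0 := fun t ht => by rw [hF]; exact (h.mem_base t ht).ne'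
  obtain ⟨c, hc⟩ : ∃ c : ℝ → ℝ, c = fun t => deriv (fun t => γ t 0) t / F t := ⟨_, rfl⟩
  obtain ⟨s, hs⟩ : ∃ s : ℝ → ℝ, s = fun t => deriv (fun t => γ t 1) t / F t := ⟨_, rfl⟩
  have hcsm : ContDiffOn ℝ ∞ c I := hc ▸ (hd (hsm 0)).div hFsm hF0
  have hssm : ContDiffOn ℝ ∞ s I := hs ▸ (hd (hsm 1)).div hFsm hF0
  have hcs : ∀ t ∈ I, c t ^ 2 + s t ^ 2 = 1 := by
    intro t ht
    have hu := h.unit_speed t ht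
    have hFt := hF0 t ht
    have hdγ : ∀ a, deriv γ t a = deriv (fun t => γ t a) t := fun a =>
      (hasDerivAt_pi.1 (differentiableAt_of_contDiffOn h.isOpen h.smooth ht).hasDerivAt a).deriv.symm
    simp only [baseMetric, Matrix.mulVec_diagonal, dotProduct, Fin.sum_univ_two, hdγ,
      Matrix.cons_val_zero, Matrix.cons_val_one, congrFun hF.symm t] at hu
    rw [hc, hs]
    rw [← hu]
    field_simp
  have horth : ∀ t ∈ I, c t * deriv c t + s t * deriv s t = 0 := by
    intro t ht
    have h1 := ((hD hcsm t ht).fun_pow 2).fun_add ((hD hssm t ht).fun_pow 2)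
    have h2 : (fun t => c t ^ 2 + s t ^ 2) =ᶠ[nhds t] fun _ => 1 := by
      filter_upwards [h.isOpen.mem_nhds ht] with r hr using hcs r hr
    have h3 := h1.unique ((hasDerivAt_const t 1).congr_of_eventuallyEq h2)
    push_cast at h3
    linear_combination h3 / 2
  refine ⟨c, s, fun t => c t * deriv s t - s t * deriv c t, h.isOpen, h.mem_base, ?_, ?_, ?_, ?_,
    hcs, ?_⟩
  · intro t ht
    refine (hD (hsm 0) t ht).congr_deriv ?_
    have hFt := hF0 t ht
    rw [show factor m (γ t 0) (γ t 1) = F t by rw [hF], hc]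
    field_simp
  · intro t ht
    refine (hD (hsm 1) t ht).congr_deriv ?_
    have hFt := hF0 t ht
    rw [show factor m (γ t 0) (γ t 1) = F t by rw [hF], hs]
    field_simp
  · intro t ht
    refine (hD hcsm t ht).congr_deriv ?_
    linear_combination c t * horth t ht - deriv c t * hcs t ht
  · intro t ht
    refine (hD hssm t ht).congr_deriv ?_
    linear_combination s t * horth t ht - deriv s t * hcs t ht
  · exact ((hcsm.mul (hd hssm)).sub (hssm.mul (hd hcsm))).add
      (contDiffOn_const.mul ((hcsm.mul (hsm 1)).sub ((hsm 0).mul hssm)))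

/-! ### Analysis of the biharmonic equations for `l ≠ 0` -/

theorem eqOn_const_of_partialD_eq_zero {n : ℕ} {v : (Fin n → ℝ) → ℝ} {U : Set (Fin n → ℝ)}
    (hU : IsOpen U) (hUc : IsPreconnected U) (hv : ∀ p ∈ U, DifferentiableAt ℝ v p)
    (h : ∀ p ∈ U, ∀ i, partialD i v p = 0) : ∃ a, ∀ p ∈ U, v p = a := by
  refine hU.exists_is_const_of_fderiv_eq_zero hUc
    (fun p hp => (hv p hp).differentiableWithinAt) ?_
  intro p hp
  refine ContinuousLinearMap.coe_injective ((Pi.basisFun ℝ (Fin n)).ext fun i => ?_)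
  simpa [partialD] using h p hp i

/-- The local analysis of the equations of a biharmonic conformal immersion of a Hopf cylinder at a
point where the tension field does not vanish. -/
theorem deriv_eq_zero_of_biharmonic {l μ : ℝ} (hl : l ≠ 0) {I : Set ℝ} (hI : IsOpen I)
    {κ θ θ' : ℝ → ℝ} {A : Set (Fin 2 → ℝ)} {u : (Fin 2 → ℝ) → ℝ} (hA : IsOpen A)
    (hAI : ∀ q ∈ A, q 0 ∈ I) (hκ : ContDiffOn ℝ ∞ κ I) (hθ : ∀ t ∈ I, HasDerivAt θ (θ' t) t)
    (hu : ContDiffOn ℝ ∞ u A) (hu0 : ∀ q ∈ A, u q ≠ 0) (hκ0 : ∀ q ∈ A, κ (q 0) ≠ 0)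
    (e1 : ∀ q ∈ A, partialD 0 u q = θ (q 0) * partialD 1 u q)
    (e2 : ∀ q ∈ A, l * partialD 1 u q = u q * deriv κ (q 0))
    (e3 : ∀ q ∈ A, partialD 0 (partialD 0 u) q
        - θ (q 0) * (partialD 0 (partialD 1 u) q + partialD 1 (partialD 0 u) q)
        + (1 + θ (q 0) ^ 2) * partialD 1 (partialD 1 u) q - θ' (q 0) * partialD 1 u q
        = u q * (κ (q 0) ^ 2 + μ)) {p : Fin 2 → ℝ} (hp : p ∈ A) :
    deriv κ (p 0) = 0 ∧ partialD 0 u p = 0 ∧ partialD 1 u p = 0 := by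
  have hκ'sm : ContDiffOn ℝ ∞ (deriv κ) I := hκ.deriv_of_isOpen hI (by simp)
  have ud : ∀ q ∈ A, DifferentiableAt ℝ u q := fun q hq => differentiableAt_of_contDiffOn hA hu hq
  have u1d : ∀ q ∈ A, DifferentiableAt ℝ (partialD 1 u) q := fun q hq =>
    differentiableAt_of_contDiffOn hA (contDiffOn_partialD hA hu 1) hq
  -- Differentiating `e1` and `e2` gives `l uₛ_z = uₛκ' + uκ''` and `l u_zz = u_zκ'`. By symmetry
  -- `uₛ_z = θu_zz`, hence `l uₛ_z = uₛκ'` and `uκ'' = 0`. The left side of `e3` collapses to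
  -- `u_zz`, while `l²u_zz = uκ'²`.
  have step : ∀ q ∈ A, deriv (deriv κ) (q 0) = 0 ∧
      deriv κ (q 0) ^ 2 = l ^ 2 * (κ (q 0) ^ 2 + μ) := by
    intro q hq
    have hqI := hAI q hq
    have dθ := hθ _ hqI
    have dκ' := (differentiableAt_of_contDiffOn hI hκ'sm hqI).hasDerivAt
    obtain ⟨θd, -, -⟩ := IsFramedCurve.partialD_comp_zero dθ
    obtain ⟨κd, -, -⟩ := IsFramedCurve.partialD_comp_zero dκ'
    have a1 : DifferentiableAt ℝ (fun q => θ (q 0) * partialD 1 u q) q := θd.fun_mul (u1d q hq)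
    have a2 : DifferentiableAt ℝ (fun q => u q * deriv κ (q 0)) q := (ud q hq).fun_mul κd
    have b0 : partialD 0 (partialD 0 u) q =
        θ' (q 0) * partialD 1 u q + θ (q 0) * partialD 0 (partialD 1 u) q := by
      rw [partialD_congr hA hq e1]
      refine partialD_eq_of_hasDerivAt a1 ?_
      have := dθ.fun_mul (hasDerivAt_partialD 0 (u1d q hq))
      simpa only [Function.update_eq_self, Function.update_self] using this
    have b1 : partialD 1 (partialD 0 u) q = θ (q 0) * partialD 1 (partialD 1 u) q := by
      rw [partialD_congr hA hq e1]
      exact partialD_eq_of_hasDerivAt a1 ((hasDerivAt_partialD 1 (u1d q hq)).const_mul (θ (q 0)))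
    have c0 : l * partialD 0 (partialD 1 u) q =
        partialD 0 u q * deriv κ (q 0) + u q * deriv (deriv κ) (q 0) := by
      have l1 : partialD 0 (fun q => l * partialD 1 u q) q = l * partialD 0 (partialD 1 u) q :=
        partialD_eq_of_hasDerivAt ((u1d q hq).const_mul l)
          ((hasDerivAt_partialD 0 (u1d q hq)).const_mul l)
      rw [← l1, partialD_congr hA hq e2]
      refine partialD_eq_of_hasDerivAt a2 ?_
      have := (hasDerivAt_partialD 0 (ud q hq)).fun_mul dκ'
      simpa only [Function.update_eq_self, Function.update_self] using this
    have c1 : l * partialD 1 (partialD 1 u) q = partialD 1 u q * deriv κ (q 0) := by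
      have l1 : partialD 1 (fun q => l * partialD 1 u q) q = l * partialD 1 (partialD 1 u) q :=
        partialD_eq_of_hasDerivAt ((u1d q hq).const_mul l)
          ((hasDerivAt_partialD 1 (u1d q hq)).const_mul l)
      rw [← l1, partialD_congr hA hq e2]
      exact partialD_eq_of_hasDerivAt a2
        ((hasDerivAt_partialD 1 (ud q hq)).mul_const (deriv κ (q 0)))
    have hcomm := partialD_comm hA hu hq 0 1
    have E1 := e1 q hq
    have E2 := e2 q hq
    have E3 := e3 q hq
    have hu := hu0 q hq
    rw [b0, b1, hcomm, b1] at E3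
    rw [hcomm, b1, E1] at c0
    constructor
    · refine (mul_eq_zero.1 ?_).resolve_left hu
      linear_combination θ (q 0) * c1 - c0
    · refine mul_left_cancel₀ hu ?_
      linear_combination l ^ 2 * E3 - l * c1 - deriv κ (q 0) * E2
  obtain ⟨h1, h2⟩ := step p hp
  have hpI := hAI p hp
  have dκ := (differentiableAt_of_contDiffOn hI hκ hpI).hasDerivAt
  have dκ' := (differentiableAt_of_contDiffOn hI hκ'sm hpI).hasDerivAt
  have hcont : Continuous fun t : ℝ => Function.update p 0 t := by fun_prop
  have hev : ∀ᶠ t in nhds (p 0), Function.update p 0 t ∈ A := by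
    refine hcont.continuousAt.eventually (hA.mem_nhds ?_)
    simpa using hp
  -- Openness of `A` makes the relation an identity on an interval around `p 0`, so it may be
  -- differentiated. With `κ'' = 0` this leaves `l²κκ' = 0`.
  have heq : (fun t => deriv κ t ^ 2) =ᶠ[nhds (p 0)] fun t => l ^ 2 * (κ t ^ 2 + μ) := by
    filter_upwards [hev] with t ht
    simpa using (step _ ht).2
  have h3 := (dκ'.fun_pow 2).unique
    ((((dκ.fun_pow 2).add_const μ).const_mul (l ^ 2)).congr_of_eventuallyEq heq)
  rw [h1] at h3
  have hk0 := hκ0 p hp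
  have hk : deriv κ (p 0) = 0 := by
    have : l ^ 2 * 2 * κ (p 0) * deriv κ (p 0) = 0 := by
      push_cast at h3
      linear_combination -h3
    simpa [hl, hk0] using this
  have hz : partialD 1 u p = 0 := by
    have := e2 p hp
    simpa [hk, hl] using this
  exact ⟨hk, by rw [e1 p hp, hz, mul_zero], hz⟩

theorem not_isProperBiharmonicHopf {m l : ℝ} (hl : l ≠ 0) {I : Set ℝ} {γ : ℝ → Fin 2 → ℝ}
    {U : Set (Fin 2 → ℝ)} {f : (Fin 2 → ℝ) → ℝ} (H : IsProperBiharmonicHopf m l I γ U f) :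
    False := by
  obtain ⟨c, s, w, h⟩ := H.curve.exists_isFramedCurve
  have hU := H.isOpen
  have hUI : ∀ q ∈ U, q 0 ∈ I := H.subset
  have hf : ∀ q ∈ U, DifferentiableAt ℝ f q := fun q hq =>
    differentiableAt_of_contDiffOn hU H.smooth hq
  have hf0 : ∀ q ∈ U, f q ≠ 0 := fun q hq => (H.pos q hq).ne'
  obtain ⟨u, huf⟩ : ∃ u : (Fin 2 → ℝ) → ℝ, ∀ q, u q = f q * curv m γ c s w (q 0) :=
    ⟨_, fun _ => rfl⟩
  have hproj : ContDiffOn ℝ ∞ (fun q : Fin 2 → ℝ => q 0) U := by fun_prop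
  have hu : ContDiffOn ℝ ∞ u U := by
    rw [funext huf]
    exact H.smooth.mul (h.smooth.comp hproj hUI)
  have ud : ∀ q ∈ U, DifferentiableAt ℝ u q := fun q hq => differentiableAt_of_contDiffOn hU hu hq
  have E := fun q (hq : q ∈ U) => frameVec_eq_zero (h.pos _ (hUI q hq)).ne' (h.norm_eq _ (hUI q hq))
    ((smul_eq_zero.1 ((h.bitension_hopfCylinder l hU hUI hf hf0 hu huf hq).symm.trans
      (H.properBiharmonic.1 q hq))).resolve_left (hf0 q hq))
  have e1 : ∀ q ∈ U, partialD 0 u q = IsFramedCurve.tilt l γ c s (q 0) * partialD 1 u q :=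
    fun q hq => sub_eq_zero.1 ((mul_eq_zero.1 (E q hq).2.2).resolve_left hl)
  have hloc : ∀ q ∈ U, u q ≠ 0 → deriv (curv m γ c s w) (q 0) = 0 ∧ partialD 0 u q = 0 ∧
      partialD 1 u q = 0 := by
    intro q hq hq0
    have hA : IsOpen (U ∩ {q | u q ≠ 0}) := hu.continuousOn.isOpen_inter_preimage hU isOpen_ne
    refine deriv_eq_zero_of_biharmonic (μ := l ^ 2 - 4 * m) (A := U ∩ {q | u q ≠ 0})
      (θ := IsFramedCurve.tilt l γ c s) (θ' := deriv (IsFramedCurve.tilt l γ c s)) hl h.isOpen hA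
      (fun q hq => hUI q hq.1) h.smooth
      (fun t ht => (h.deriv_tilt l ht).differentiableAt.hasDerivAt) (hu.mono Set.inter_subset_left)
      (fun q hq => hq.2) ?_ (fun q hq => e1 q hq.1) ?_ ?_ ⟨hq, hq0⟩
    · intro q hq hκ
      exact hq.2 (by rw [huf, hκ, mul_zero])
    · intro q hq
      have := (E q hq.1).1
      rw [e1 q hq.1] at this
      linear_combination this
    · intro q hq
      linear_combination (E q hq.1).2.1
  -- The square is used because its derivative `2u du` vanishes at the zeros of `u` as well, where
  -- the local analysis says nothing.
  have husq : ∃ a, ∀ q ∈ U, u q ^ 2 = a := by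
    refine eqOn_const_of_partialD_eq_zero hU H.isConnected.isPreconnected
      (fun q hq => (ud q hq).fun_pow 2) ?_
    intro q hq i
    have hd : partialD i (fun q => u q ^ 2) q = 2 * u q * partialD i u q := by
      refine partialD_eq_of_hasDerivAt ((ud q hq).fun_pow 2) ?_
      simpa using (hasDerivAt_partialD i (ud q hq)).fun_pow 2
    rw [hd]
    by_cases hq0 : u q = 0
    · simp [hq0]
    · have := hloc q hq hq0
      fin_cases i
      · simp [this.2.1]
      · simp [this.2.2]
  obtain ⟨a, ha⟩ := husq
  -- One zero would make the constant `u²` zero, and the map would be harmonic.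
  have hu0 : ∀ q ∈ U, u q ≠ 0 := by
    intro q hq hq0
    refine H.properBiharmonic.2 fun r hr => ?_
    have hr0 : u r = 0 := by
      have := (ha r hr).trans (ha q hq).symm
      simpa [hq0] using this
    rw [h.tension_hopfCylinder l hU hUI hf hf0 hr]
    rw [huf] at hr0
    ext b
    fin_cases b <;> simp [IsFramedCurve.field, frameVec, hr0]
  have hfc : ∃ b, ∀ q ∈ U, f q = b := by
    refine eqOn_const_of_partialD_eq_zero hU H.isConnected.isPreconnected hf ?_
    intro q hq i
    have hqI := hUI q hq
    obtain ⟨k1, k2, k3⟩ := hloc q hq (hu0 q hq)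
    have dκ := (differentiableAt_of_contDiffOn h.isOpen h.smooth hqI).hasDerivAt
    rw [k1] at dκ
    obtain ⟨κd, κ0, κ1⟩ := IsFramedCurve.partialD_comp_zero dκ
    have hκ0 : curv m γ c s w (q 0) ≠ 0 := fun hκ => hu0 q hq (by rw [huf, hκ, mul_zero])
    -- As `κ' = 0`, the product rule for `u = fκ` has a single term; `du = 0` and `κ ≠ 0` then give
    -- `df = 0`.
    have hd : partialD i u q = partialD i f q * curv m γ c s w (q 0) := by
      rw [funext huf]
      refine partialD_eq_of_hasDerivAt ((hf q hq).fun_mul κd) ?_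
      have := (hasDerivAt_partialD i (hf q hq)).fun_mul (hasDerivAt_partialD i κd)
      have hz : partialD i (fun q : Fin 2 → ℝ => curv m γ c s w (q 0)) q = 0 := by
        fin_cases i
        · exact κ0
        · exact κ1
      simpa [hz] using this
    have hz : partialD i u q = 0 := by
      fin_cases i
      · exact k2
      · exact k3
    rw [hz] at hd
    exact (mul_eq_zero.1 hd.symm).resolve_right hκ0
  obtain ⟨b, hb⟩ := hfc
  exact H.nonconstant ⟨√b, fun q hq => by rw [hb q hq]⟩

/-! ### The product spaces, `l = 0` -/

theorem metric_zero_right (m : ℝ) (p : Fin 3 → ℝ) : metric m 0 p = productMetric (4 * m) p := by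
  ext i j
  fin_cases i <;> fin_cases j <;> simp [metric, productMetric, form, factor]

theorem space_eq (m : ℝ) : space m = {p | 0 < 1 + 4 * m / 4 * (p 0 ^ 2 + p 1 ^ 2)} := by
  simp [space, factor]

theorem product_of_eq_zero (m : ℝ) :
    IsSphereTimesLine m 0 ∨ IsHyperbolicPlaneTimesLine m 0 ∨ IsEuclidean m 0 := by
  rcases lt_trichotomy m 0 with hm | rfl | hm
  · exact .inr (.inl ⟨4 * m, by linarith, space_eq m, fun p _ => metric_zero_right m p⟩)
  · refine .inr (.inr ⟨by simp [space, factor], fun p => ?_⟩)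
    rw [metric_zero_right]
    ext i j
    fin_cases i <;> fin_cases j <;> simp [productMetric]
  · exact .inl ⟨4 * m, by linarith, space_eq m, fun p _ => metric_zero_right m p⟩

end BCV
end

theorem mainTheorem6 (m l : ℝ) :
    ((∃ (I : Set ℝ) (γ : ℝ → Fin 2 → ℝ) (U : Set (Fin 2 → ℝ)) (f : (Fin 2 → ℝ) → ℝ),
        BCV.IsProperBiharmonicHopf m l I γ U f) →
      BCV.IsSphereTimesLine m l ∨ BCV.IsHyperbolicPlaneTimesLine m l ∨ BCV.IsEuclidean m l) ∧
    ((BCV.IsSphere m l ∨ BCV.IsNil m l ∨ BCV.IsSLTilde m l ∨ BCV.IsSU m l) →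
      ¬ ∃ (I : Set ℝ) (γ : ℝ → Fin 2 → ℝ) (U : Set (Fin 2 → ℝ)) (f : (Fin 2 → ℝ) → ℝ),
        BCV.IsProperBiharmonicHopf m l I γ U f) := by
  constructor
  · rintro ⟨I, γ, U, f, H⟩
    by_cases hl : l = 0
    · subst hl
      exact BCV.product_of_eq_zero m
    · exact (BCV.not_isProperBiharmonicHopf hl H).elim
  · rintro h ⟨I, γ, U, f, H⟩
    -- All four geometries enter only through the nonvanishing of `l`.
    have hl : l ≠ 0 := by
      rcases h with h | h | h | h <;> exact h.1
    exact BCV.not_isProperBiharmonicHopf hl H
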